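/- Notation. For $0\le k\le n$ let $\nu_k$ be the uniform distribution on the slice $\binom{[n]}{k}=\{x\in\{0,1\}^n:\sum_i x_i=k\}$, and $\|f\|_{\nu_k}=\sqrt{\mathbb E_{\nu_k}[f^2]}$. For a uniformly random permutation $\pi\in S_n$ and $0\le s\le n$ let $\mathbf X(s)\in\binom{[n]}{s}$ be the point with $\mathbf X(s)_i=1$ if and only if $i\in\pi(\{1,\dots,s\})$. Given $p\in(0,1)$, numbers $k_1,\dots,k_r\in\{0,\dots,n\}$ form an $(\eta,M)$-system, where $0<\eta\le1$ and $M\ge1$, if the numbers $\sigma_i=\frac{k_i-np}{\sqrt{np(1-p)}}$ satisfy $|\sigma_i-\sigma_j|\ge\eta$ for all $i\ne j$ and $|\sigma_i|\le M$ for all $i$. The profile of a polynomial $f$ with respect to $k_1,\dots,k_r$ is the joint distribution of $(\mathbf f_1,\dots,\mathbf f_r)=(f(\mathbf X(k_1)),\dots,f(\mathbf X(k_r)))$. Theorem. There exist absolute constants $K,C>0$ such that the following holds. Let $p\in(0,1)$, let $n$ and $d$ be integers with $1\le d\le\sqrt{Knp(1-p)}$, let $k_1,\dots,k_{d+1}$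 be an $(\eta,M)$-system with $M\le\sqrt{np(1-p)}/2$, and let $k=np+\sigma\sqrt{np(1-p)}\in\{0,\dots,n\}$ be such that \[ L:=\max_i|\sigma-\sigma_i|\le\frac{\sqrt{np(1-p)}}{8d}. \] Then there are real numbers $\gamma_{k1},\dots,\gamma_{k(d+1)}$, depending only on $n,p,d,k$ and $k_1,\dots,k_{d+1}$, such that \[ |\gamma_{ki}|\le\left(C(1+|\sigma|)\frac M\eta\right)^d\qquad(1\le i\le d+1), \] and such that for every real multilinear polynomial $f$ in $x_1,\dots,x_n$ of degree at most $d$ with $\|f\|_{\nu_{k_i}}\le1$ for all $1\le i\le d+1$, and every $1$-Lipschitz function $\varphi\colon\mathbb R\to\mathbb R$, \[ \left|\mathbb E_{\nu_k}[\varphi(f)]-\mathbb E\Big[\varphi\Big(\sum_{i=1}^{d+1}\gamma_{ki}\mathbf f_i\Big)\Big]\right|\le\left(C(1+|\sigma|)\frac M\eta\right)^d\sqrt{\frac{L}{\sqrt{np(1-p)}}}, \] where $(\mathbf f_1,\dots,\mathbf f_{d+1})$ is the profile of $f$ with respect to $k_1,\dots,k_{d+1}$. -/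

import Mathlib

open MeasureTheory ProbabilityTheory

noncomputable section

namespace SliceInvariance

/-- The Boolean cube `{0,1}^n`. -/
abbrev Cube (n : ℕ) : Type := Fin n → Fin 2

/-- The `k`-th slice of the Boolean cube: the points with exactly `k` coordinates equal to 1. -/
def slice (n k : ℕ) : Set (Cube n) := {x | ∑ i, (x i : ℕ) = k}

/-- The uniform probability measure on the `k`-th slice. -/
def nu (n k : ℕ) : Measure (Cube n) := uniformOn (slice n k)

/-- Every monomial of `f` is squarefree. -/
def IsMultilinear {n : ℕ} (f : MvPolynomial (Fin n) ℝ) : Prop :=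
  ∀ m ∈ f.support, ∀ i, m i ≤ 1

/-- The value of the polynomial `f` at a point of the Boolean cube. -/
def evalCube {n : ℕ} (f : MvPolynomial (Fin n) ℝ) (x : Cube n) : ℝ :=
  MvPolynomial.eval (fun i => ((x i : ℕ) : ℝ)) f

/-- The `L₂` norm of `f` with respect to the uniform measure on the `k`-th slice. -/
def sliceNorm {n : ℕ} (k : ℕ) (f : MvPolynomial (Fin n) ℝ) : ℝ :=
  Real.sqrt (∫ x, (evalCube f x) ^ 2 ∂(nu n k))

/-- The standard deviation `√(n p (1 - p))` of the binomial distribution. -/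
def stdDev (n : ℕ) (p : ℝ) : ℝ := Real.sqrt (n * p * (1 - p))

/-- The normalized level `σ` of the `k`-th slice, so that `k = n p + σ √(n p (1 - p))`. -/
def sig (n : ℕ) (p : ℝ) (k : ℕ) : ℝ := (k - n * p) / stdDev n p

/-- The levels `κ 0, …, κ (r - 1)` form an `(η, M)`-system. -/
structure IsSystem (n : ℕ) (p η M : ℝ) {r : ℕ} (κ : Fin r → ℕ) : Prop where
  eta_pos : 0 < η
  eta_le_one : η ≤ 1
  one_le_M : 1 ≤ M
  le_n : ∀ i, κ i ≤ n
  separated : ∀ i j, i ≠ j → η ≤ |sig n p (κ i) - sig n p (κ j)|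
  bounded : ∀ i, |sig n p (κ i)| ≤ M

/-- The point `X(s)` of the maximal chain given by a permutation `π`: its `i`-th coordinate is 1
iff `i` is one of the images under `π` of the first `s` indices. -/
def chain {n : ℕ} (π : Equiv.Perm (Fin n)) (s : ℕ) : Cube n :=
  fun i => if (π.symm i : ℕ) < s then 1 else 0

/-- The profile of `f`: the joint distribution of `f(X(κ 0)), …, f(X(κ (r - 1)))`, for a uniformly
random permutation. -/
def profile {n r : ℕ} (f : MvPolynomial (Fin n) ℝ) (κ : Fin r → ℕ) : Measure (Fin r → ℝ) :=
  ((PMF.uniformOfFintype (Equiv.Perm (Fin n))).map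
    (fun π i => evalCube f (chain π (κ i)))).toMeasure

/-- `L = max_i |σ - σ_i|`, for the `k`-th slice and the levels `κ i`. -/
def maxDist (n : ℕ) (p : ℝ) (k : ℕ) {r : ℕ} (κ : Fin r → ℕ) : ℝ :=
  ⨆ i, |sig n p k - sig n p (κ i)|

end SliceInvariance

end

/-!
Write `X(s)` for the points of the random chain and `E` for the expectation over the permutation.
Since `φ` is 1-Lipschitz and `X(s)` is uniform on the slice `s` (`integral_nu`), it suffices to find
`γ` with `f(X(k)) ≈ ∑ i, γ i * f(X(κ i))` in `L²`.

A polynomial of degree at most `d` is, as a function on the cube, a combination of products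
`(∑ i, x i) ^ a * h` with `h` harmonic of degree `j` and `a + j ≤ d`
(`evalCube_mem_harmonicSpan`). The reason is that raising and lowering are adjoint to each other on
homogeneous multilinear polynomials, so each of these is harmonic up to a polynomial in the range
of raising, and on the cube raising a polynomial of degree `m` is multiplication by
`(∑ i, x i) - m`. On the slice `s` the factor
`(∑ i, x i) ^ a` is the number `s ^ a`. So the harmonic function that agrees with `f` on the slice
`s` depends on `s` polynomially, with degree at most `d`, and Lagrange interpolation with nodes
`κ i` gives numbers `γ i` and sums `F i` of harmonic functions such that `f = F i` on the slice
`κ i` and `f = ∑ i, γ i * F i` on the slice `k` (`exists_harmonic_interpolation`). Hence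
`f(X(k)) - ∑ i, γ i * f(X(κ i)) = ∑ i, γ i * (F i (X(k)) - F i (X(κ i)))`.

It remains to see that harmonic functions change little between nearby slices. A harmonic `h` of
degree `j` is an eigenfunction of both one-step transitions of the chain:
`E[h(X(s + 1)) | X(s)] = (1 - j / (n - s)) h(X(s))` and
`E[h(X(s)) | X(s + 1)] = (1 - j / (s + 1)) h(X(s + 1))`. Playing these off against each other
shows that harmonic functions of different degrees are orthogonal on each slice
(`sum_mul_harmonic_eq_zero`), and iterating them shows that the correlation between
`h(X(s))` and `h(X(t))` is within `O(j |t - s| / min(s, t, n - s, n - t))` of 1, which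
gives the `L²` estimate `sum_sq_sub_sum_harmonic_le`. Here the minimum is at least
`3 / 8 * n p (1 - p)` (`mul_sq_stdDev_le`), which turns the error into `O(d L / √(n p (1 - p)))`.

Expectations over the permutation are written as sums over all permutations.
-/

namespace SliceInvariance

open Finset

variable {n : ℕ}

/-! ### The random maximal chain -/

/-- The set of images under `π` of the first `s` indices: the chain point `X(s)` as a finset. -/
def initialImage (π : Equiv.Perm (Fin n)) (s : ℕ) : Finset (Fin n) :=
  univ.filter fun i => (π.symm i : ℕ) < s

lemma mem_initialImage {π : Equiv.Perm (Fin n)} {s : ℕ} {i : Fin n} :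
    i ∈ initialImage π s ↔ (π.symm i : ℕ) < s := by
  simp [initialImage]

lemma card_initialImage (π : Equiv.Perm (Fin n)) {s : ℕ} (hs : s ≤ n) :
    #(initialImage π s) = s := by
  have h : initialImage π s = (univ.filter fun u : Fin n => (u : ℕ) < s).map π.toEmbedding := by
    ext i
    simp only [mem_initialImage, mem_map_equiv, mem_filter, mem_univ, true_and]
  rw [h, card_map, Fin.card_filter_val_lt, min_eq_right hs]

lemma initialImage_mul_swap {π : Equiv.Perm (Fin n)} {s : ℕ} {u v : Fin n}
    (h : (u : ℕ) < s ↔ (v : ℕ) < s) :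
    initialImage (π * Equiv.swap u v) s = initialImage π s := by
  ext i
  have : (π * Equiv.swap u v).symm i = Equiv.swap u v (π.symm i) := rfl
  rw [mem_initialImage, mem_initialImage, this, Equiv.swap_apply_def]
  split_ifs with h1 h2
  · rw [h1, h]
  · rw [h2, h]
  · rfl

lemma initialImage_succ (π : Equiv.Perm (Fin n)) (t : Fin n) :
    initialImage π (t + 1) = insert (π t) (initialImage π t) := by
  ext i
  rw [mem_insert, mem_initialImage, mem_initialImage, Nat.lt_succ_iff, le_iff_lt_or_eq, or_comm,
    Fin.val_inj, Equiv.symm_apply_eq]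

lemma initialImage_erase (π : Equiv.Perm (Fin n)) (t : Fin n) :
    (initialImage π (t + 1)).erase (π t) = initialImage π t := by
  rw [initialImage_succ, erase_insert]
  simp [mem_initialImage]

/-- The Markov property of the chain, upwards: given `X(t)`, the point `X(t + 1)` arises by adding
a uniformly random new element. -/
lemma sum_chain_up {s : ℕ} {t : Fin n} (hst : s ≤ t) (F g : Finset (Fin n) → ℝ) :
    ((n : ℝ) - (t : ℕ)) *
        ∑ π : Equiv.Perm (Fin n), F (initialImage π s) * g (initialImage π (t + 1)) =
      ∑ π : Equiv.Perm (Fin n), F (initialImage π s) *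
        ∑ y ∈ (initialImage π t)ᶜ, g (insert y (initialImage π t)) := by
  have h1 : ∀ π : Equiv.Perm (Fin n), ∑ y ∈ (initialImage π t)ᶜ, g (insert y (initialImage π t)) =
      ∑ u ∈ univ.filter (fun u : Fin n => ¬ (u : ℕ) < t), g (insert (π u) (initialImage π t)) := by
    intro π
    symm
    refine sum_equiv π ?_ (fun _ _ => rfl)
    intro i
    simp [mem_initialImage]
  have hcard : (#(univ.filter (fun u : Fin n => ¬ (u : ℕ) < t)) : ℝ) = (n : ℝ) - (t : ℕ) := by
    have := Finset.card_filter_add_card_filter_not (s := (univ : Finset (Fin n)))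
      (fun u : Fin n => (u : ℕ) < t)
    rw [Fin.card_filter_val_lt, min_eq_right t.2.le, card_univ, Fintype.card_fin] at this
    rw [← Nat.cast_sub t.2.le]
    congr 1
    omega
  simp_rw [h1, mul_sum]
  rw [sum_comm, ← mul_sum, ← hcard, ← nsmul_eq_mul, ← sum_const]
  refine sum_congr rfl fun u hu => ?_
  have hu : ¬ (u : ℕ) < t := (mem_filter.1 hu).2
  refine Fintype.sum_equiv (Equiv.mulRight (Equiv.swap t u)) _ _ fun π => ?_
  have e1 : initialImage (π * Equiv.swap t u) s = initialImage π s :=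
    initialImage_mul_swap (by omega)
  have e2 : initialImage (π * Equiv.swap t u) t = initialImage π t :=
    initialImage_mul_swap (by omega)
  simp only [Equiv.coe_mulRight, e1, e2, Equiv.Perm.mul_apply, Equiv.swap_apply_right,
    initialImage_succ]

/-- The Markov property of the chain, downwards: given `X(s + 1)`, the point `X(s)` arises by
removing a uniformly random element. -/
lemma sum_chain_down {t : ℕ} {s : Fin n} (hst : s < t) (F g : Finset (Fin n) → ℝ) :
    (((s : ℕ) : ℝ) + 1) *
        ∑ π : Equiv.Perm (Fin n), F (initialImage π t) * g (initialImage π s) =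
      ∑ π : Equiv.Perm (Fin n), F (initialImage π t) *
        ∑ y ∈ initialImage π (s + 1), g ((initialImage π (s + 1)).erase y) := by
  have h1 : ∀ π : Equiv.Perm (Fin n),
      ∑ y ∈ initialImage π (s + 1), g ((initialImage π (s + 1)).erase y) =
      ∑ u ∈ univ.filter (fun u : Fin n => (u : ℕ) < s + 1),
        g ((initialImage π (s + 1)).erase (π u)) := by
    intro π
    symm
    refine sum_equiv π ?_ (fun _ _ => rfl)
    intro i
    simp [mem_initialImage]
  have hcard : (#(univ.filter (fun u : Fin n => (u : ℕ) < s + 1)) : ℝ) = ((s : ℕ) : ℝ) + 1 := by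
    rw [Fin.card_filter_val_lt, min_eq_right (by omega)]
    push_cast
    rfl
  simp_rw [h1, mul_sum]
  rw [sum_comm, ← mul_sum, ← hcard, ← nsmul_eq_mul, ← sum_const]
  refine sum_congr rfl fun u hu => ?_
  have hu : (u : ℕ) < s + 1 := (mem_filter.1 hu).2
  refine Fintype.sum_equiv (Equiv.mulRight (Equiv.swap s u)) _ _ fun π => ?_
  have e1 : initialImage (π * Equiv.swap s u) t = initialImage π t :=
    initialImage_mul_swap (by omega)
  have e2 : initialImage (π * Equiv.swap s u) (s + 1) = initialImage π (s + 1) :=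
    initialImage_mul_swap (by omega)
  simp only [Equiv.coe_mulRight, e1, e2, Equiv.Perm.mul_apply, Equiv.swap_apply_right,
    initialImage_erase]

/-! ### Harmonic functions along the chain -/

/-- The harmonic functions of degree `j`: the values, at indicator vectors of sets `A`, of the
multilinear polynomials `h` that are homogeneous of degree `j` and satisfy `∑ y, ∂h/∂x_y = 0`.
They are encoded by the two eigenvalue equations which these properties give: the first sums
`h` over the sets that cover `A`, the second over the sets that `A` covers. -/
def harmonic (n j : ℕ) : Submodule ℝ (Finset (Fin n) → ℝ) where
  carrier := {h | ∀ A, ∑ y ∈ Aᶜ, h (insert y A) = ((n : ℝ) - #A - j) * h A ∧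
    ∑ y ∈ A, h (A.erase y) = ((#A : ℝ) - j) * h A}
  zero_mem' := by intro A; simp
  add_mem' := by
    intro f g hf hg A
    simp only [Pi.add_apply, sum_add_distrib, hf A, hg A]
    constructor <;> ring
  smul_mem' := by
    intro c f hf A
    simp only [Pi.smul_apply, smul_eq_mul, ← mul_sum, hf A]
    constructor <;> ring

lemma sum_chain_up_harmonic {j s : ℕ} {t : Fin n} (hst : s ≤ t) (F : Finset (Fin n) → ℝ)
    {g : Finset (Fin n) → ℝ} (hg : g ∈ harmonic n j) :
    ((n : ℝ) - (t : ℕ)) *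
        ∑ π : Equiv.Perm (Fin n), F (initialImage π s) * g (initialImage π (t + 1)) =
      ((n : ℝ) - (t : ℕ) - j) *
        ∑ π : Equiv.Perm (Fin n), F (initialImage π s) * g (initialImage π t) := by
  rw [sum_chain_up hst, mul_sum]
  refine sum_congr rfl fun π _ => ?_
  rw [(hg _).1, card_initialImage π t.2.le]
  ring

lemma sum_chain_down_harmonic {j t : ℕ} {s : Fin n} (hst : s < t) (F : Finset (Fin n) → ℝ)
    {g : Finset (Fin n) → ℝ} (hg : g ∈ harmonic n j) :
    (((s : ℕ) : ℝ) + 1) *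
        ∑ π : Equiv.Perm (Fin n), F (initialImage π t) * g (initialImage π s) =
      (((s : ℕ) : ℝ) + 1 - j) *
        ∑ π : Equiv.Perm (Fin n), F (initialImage π t) * g (initialImage π (s + 1)) := by
  rw [sum_chain_down hst, mul_sum]
  refine sum_congr rfl fun π _ => ?_
  rw [(hg _).2, card_initialImage π (Nat.succ_le_of_lt s.2)]
  push_cast
  ring

/-- Harmonic functions of different degrees are orthogonal on every slice. Computing
`E[h(X(s)) g(X(s + 1))]` by conditioning on either point relates the inner products on the slices
`s` and `s + 1`; exchanging the roles of `h` and `g` gives a second relation, and the two together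
have only the zero solution. -/
lemma sum_mul_harmonic_eq_zero {i j s : ℕ} (hij : i ≠ j) (hn : i + j ≤ n) (hs : s < n)
    {h g : Finset (Fin n) → ℝ} (hh : h ∈ harmonic n i) (hg : g ∈ harmonic n j) :
    ∑ π : Equiv.Perm (Fin n), h (initialImage π s) * g (initialImage π s) = 0 := by
  have a1 := sum_chain_up_harmonic (t := ⟨s, hs⟩) le_rfl h hg
  have a2 := sum_chain_up_harmonic (t := ⟨s, hs⟩) le_rfl g hh
  have b1 := sum_chain_down_harmonic (s := ⟨s, hs⟩) (t := s + 1) (Nat.lt_succ_self s) g hh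
  have b2 := sum_chain_down_harmonic (s := ⟨s, hs⟩) (t := s + 1) (Nat.lt_succ_self s) h hg
  have comm : ∀ u v : ℕ, ∑ π : Equiv.Perm (Fin n), g (initialImage π u) * h (initialImage π v) =
      ∑ π : Equiv.Perm (Fin n), h (initialImage π v) * g (initialImage π u) :=
    fun u v => sum_congr rfl fun π _ => mul_comm _ _
  simp only [comm] at a2 b1
  set P := ∑ π : Equiv.Perm (Fin n), h (initialImage π s) * g (initialImage π s)
  set P' := ∑ π : Equiv.Perm (Fin n), h (initialImage π (s + 1)) * g (initialImage π (s + 1))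
  have hn' : (i : ℝ) + j ≤ n := by exact_mod_cast hn
  have hij' : (i : ℝ) - j ≠ 0 := sub_ne_zero.2 (by exact_mod_cast hij)
  have e1 : ((s : ℝ) + 1) * ((n - s - j) * P) = (n - s) * ((s + 1 - i) * P') := by
    rw [← a1, ← b1]; ring
  have e2 : ((s : ℝ) + 1) * ((n - s - i) * P) = (n - s) * ((s + 1 - j) * P') := by
    rw [← a2, ← b2]; ring
  -- eliminating `P'` leaves a factor that vanishes only for `i = j` or `i + j = n + 1`
  have key : (((s : ℝ) + 1) * (i - j) * (n + 1 - i - j)) * P = 0 := by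
    linear_combination ((s : ℝ) + 1 - j) * e1 - ((s : ℝ) + 1 - i) * e2
  refine (mul_eq_zero.1 key).resolve_left (mul_ne_zero (mul_ne_zero ?_ hij') ?_)
  · positivity
  · linarith

/-- Correlation of a harmonic function with an arbitrary function of an earlier point of the
chain: it is that on the earlier slice, damped by a factor close to 1. -/
lemma exists_sum_chain_later {j m s t : ℕ} (hst : s ≤ t) (htn : t + m ≤ n) (hjm : j ≤ m)
    (hm : 0 < m) :
    ∃ α : ℝ, 1 - j * (t - s) / m ≤ α ∧ α ≤ 1 ∧ ∀ g ∈ harmonic n j, ∀ F : Finset (Fin n) → ℝ,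
      ∑ π : Equiv.Perm (Fin n), F (initialImage π s) * g (initialImage π t) =
        α * ∑ π : Equiv.Perm (Fin n), F (initialImage π s) * g (initialImage π s) := by
  induction t, hst using Nat.le_induction with
  | base => exact ⟨1, by simp, le_rfl, fun g _ F => (one_mul _).symm⟩
  | succ t hst ih =>
    obtain ⟨α, h1, h2, h3⟩ := ih (by omega)
    have hm' : (0 : ℝ) < m := by exact_mod_cast hm
    have htn' : (t : ℝ) + 1 + m ≤ n := by exact_mod_cast htn
    have hjm' : (j : ℝ) ≤ m := by exact_mod_cast hjm
    have hu : (0 : ℝ) < n - t := by linarith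
    have ha : (j : ℝ) / (n - t) ≤ j / m := by gcongr; linarith
    have ha1 : (j : ℝ) / m ≤ 1 := div_le_one_of_le₀ hjm' hm'.le
    have ha0 : (0 : ℝ) ≤ j / (n - t) := by positivity
    have e : (j : ℝ) * ((t + 1 : ℕ) - s) / m = j * (t - s) / m + j / m := by
      push_cast; ring
    refine ⟨α * (1 - j / (n - t)), ?_, ?_, fun g hg F => ?_⟩
    · rw [e]; nlinarith
    · nlinarith
    · have := sum_chain_up_harmonic (t := ⟨t, by omega⟩) hst F hg
      simp only [h3 g hg F] at this
      field_simp
      linear_combination this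

/-- The counterpart of `exists_sum_chain_later` for a function of a later point of the chain. -/
lemma exists_sum_chain_earlier {j m s t : ℕ} (hst : s ≤ t) (htn : t ≤ n) (hms : m ≤ s)
    (hjm : j ≤ m) (hm : 0 < m) :
    ∃ α : ℝ, 1 - j * (t - s) / m ≤ α ∧ α ≤ 1 ∧ ∀ g ∈ harmonic n j, ∀ F : Finset (Fin n) → ℝ,
      ∑ π : Equiv.Perm (Fin n), F (initialImage π t) * g (initialImage π s) =
        α * ∑ π : Equiv.Perm (Fin n), F (initialImage π t) * g (initialImage π t) := by
  induction hst using Nat.decreasingInduction with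
  | self => exact ⟨1, by simp, le_rfl, fun g _ F => (one_mul _).symm⟩
  | of_succ s hst ih =>
    obtain ⟨α, h1, h2, h3⟩ := ih (by omega)
    have hm' : (0 : ℝ) < m := by exact_mod_cast hm
    have hms' : (m : ℝ) ≤ s := by exact_mod_cast hms
    have hjm' : (j : ℝ) ≤ m := by exact_mod_cast hjm
    have hu : (0 : ℝ) < s + 1 := by positivity
    have ha : (j : ℝ) / (s + 1) ≤ j / m := by gcongr; linarith
    have ha1 : (j : ℝ) / m ≤ 1 := div_le_one_of_le₀ hjm' hm'.le
    have ha0 : (0 : ℝ) ≤ j / (s + 1) := by positivity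
    have e : (j : ℝ) * (t - s) / m = j * (t - (s + 1 : ℕ)) / m + j / m := by
      push_cast; ring
    refine ⟨α * (1 - j / (s + 1)), ?_, ?_, fun g hg F => ?_⟩
    · rw [e]; nlinarith
    · nlinarith
    · have := sum_chain_down_harmonic (s := ⟨s, by omega⟩) hst F hg
      simp only [h3 g hg F] at this
      field_simp
      linear_combination this

/-- Correlation of a harmonic function with an arbitrary function of another point of the chain,
whose level may be higher or lower. -/
lemma exists_sum_chain {j m s t : ℕ} (hsn : s + m ≤ n) (htn : t + m ≤ n) (hmt : m ≤ t) (hjm : j ≤ m)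
    (hm : 0 < m) :
    ∃ α : ℝ, 1 - j * |(t : ℝ) - s| / m ≤ α ∧ α ≤ 1 ∧
      ∀ g ∈ harmonic n j, ∀ F : Finset (Fin n) → ℝ,
        ∑ π : Equiv.Perm (Fin n), F (initialImage π s) * g (initialImage π t) =
          α * ∑ π : Equiv.Perm (Fin n), F (initialImage π s) * g (initialImage π s) := by
  rcases le_total s t with h | h
  · rw [abs_of_nonneg (sub_nonneg.2 (by exact_mod_cast h))]
    exact exists_sum_chain_later h htn hjm hm
  · rw [abs_sub_comm, abs_of_nonneg (sub_nonneg.2 (by exact_mod_cast h))]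
    exact exists_sum_chain_earlier h (by omega) hmt hjm hm

/-- The values of a harmonic function at two nearby points of the chain are close in `L²`. -/
lemma sum_sq_sub_harmonic_le {j m s t : ℕ} (hsn : s + m ≤ n) (htn : t + m ≤ n) (hms : m ≤ s)
    (hmt : m ≤ t) (hjm : j ≤ m) (hm : 0 < m) {x : ℝ} (hx : j * |(t : ℝ) - s| / m ≤ x)
    (hx3 : x ≤ 1 / 3) {g : Finset (Fin n) → ℝ} (hg : g ∈ harmonic n j) :
    ∑ π : Equiv.Perm (Fin n), (g (initialImage π t) - g (initialImage π s)) ^ 2 ≤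
      4 * x * ∑ π : Equiv.Perm (Fin n), g (initialImage π s) ^ 2 := by
  obtain ⟨α, a1, a2, a3⟩ := exists_sum_chain hsn htn hmt hjm hm
  obtain ⟨β, b1, b2, b3⟩ := exists_sum_chain htn hsn hms hjm hm
  have ha := a3 g hg g
  have hb := b3 g hg g
  rw [abs_sub_comm] at b1
  have comm : ∑ π : Equiv.Perm (Fin n), g (initialImage π t) * g (initialImage π s) =
      ∑ π : Equiv.Perm (Fin n), g (initialImage π s) * g (initialImage π t) :=
    sum_congr rfl fun π _ => mul_comm _ _
  rw [comm, ha] at hb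
  have e : ∑ π : Equiv.Perm (Fin n), (g (initialImage π t) - g (initialImage π s)) ^ 2 =
      ∑ π : Equiv.Perm (Fin n), g (initialImage π t) * g (initialImage π t) +
      ∑ π : Equiv.Perm (Fin n), g (initialImage π s) * g (initialImage π s) -
      2 * ∑ π : Equiv.Perm (Fin n), g (initialImage π s) * g (initialImage π t) := by
    rw [mul_sum, ← sum_add_distrib, ← sum_sub_distrib]
    exact sum_congr rfl fun π _ => by ring
  have e' : ∑ π : Equiv.Perm (Fin n), g (initialImage π s) ^ 2 =
      ∑ π : Equiv.Perm (Fin n), g (initialImage π s) * g (initialImage π s) :=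
    sum_congr rfl fun π _ => sq _
  have hP : 0 ≤ ∑ π : Equiv.Perm (Fin n), g (initialImage π s) * g (initialImage π s) :=
    sum_nonneg fun π _ => mul_self_nonneg _
  have hQ : 0 ≤ ∑ π : Equiv.Perm (Fin n), g (initialImage π t) * g (initialImage π t) :=
    sum_nonneg fun π _ => mul_self_nonneg _
  rw [e, e', ha]
  set P := ∑ π : Equiv.Perm (Fin n), g (initialImage π s) * g (initialImage π s)
  set Q := ∑ π : Equiv.Perm (Fin n), g (initialImage π t) * g (initialImage π t)
  have hx0 : 0 ≤ x := by linarith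
  have h1 : (1 - x) * Q ≤ P := by nlinarith
  have h2 : Q ≤ (1 + 2 * x) * P := by
    -- `1 ≤ (1 - x) * (1 + 2 * x)` because `x ≤ 1 / 2`
    have : (1 + 2 * x) * ((1 - x) * Q) ≤ (1 + 2 * x) * P := by gcongr
    nlinarith [mul_nonneg (mul_nonneg hx0 (by linarith : 0 ≤ 1 - 2 * x)) hQ]
  nlinarith

lemma sum_sq_sum_of_orthogonal {ι : Type*} {Ω : Type*} (I : Finset ι) [Fintype Ω] (Y : ι → Ω → ℝ)
    (h : ∀ i ∈ I, ∀ j ∈ I, i ≠ j → ∑ π, Y i π * Y j π = 0) :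
    ∑ π, (∑ i ∈ I, Y i π) ^ 2 = ∑ i ∈ I, ∑ π, Y i π ^ 2 := by
  classical
  simp_rw [sq, sum_mul_sum]
  rw [sum_comm]
  refine sum_congr rfl fun i hi => ?_
  rw [sum_comm, sum_eq_single_of_mem i hi fun j hj hji => h i hi j hj hji.symm]

/-- The invariance principle between two nearby slices, in `L²`, for sums of harmonic functions of
degrees at most `d`. -/
lemma sum_sq_sub_sum_harmonic_le {d m s t : ℕ} (hsn : s + m ≤ n) (htn : t + m ≤ n) (hms : m ≤ s)
    (hmt : m ≤ t) (hdm : d ≤ m) (hm : 0 < m) {x : ℝ} (hx : d * |(t : ℝ) - s| / m ≤ x)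
    (hx3 : x ≤ 1 / 3) {h : ℕ → Finset (Fin n) → ℝ} (hh : ∀ j, h j ∈ harmonic n j) :
    ∑ π : Equiv.Perm (Fin n), (∑ j ∈ range (d + 1), h j (initialImage π t) -
        ∑ j ∈ range (d + 1), h j (initialImage π s)) ^ 2 ≤
      4 * x * ∑ π : Equiv.Perm (Fin n), (∑ j ∈ range (d + 1), h j (initialImage π s)) ^ 2 := by
  have orth : ∀ u v, u + m ≤ n → v + m ≤ n → m ≤ v → ∀ i ∈ range (d + 1),
      ∀ j ∈ range (d + 1), i ≠ j →
      ∑ π : Equiv.Perm (Fin n), h i (initialImage π u) * h j (initialImage π v) = 0 := by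
    intro u v hu1 hv1 hv2 i hi j hj hij
    have hi := mem_range.1 hi
    have hj := mem_range.1 hj
    obtain ⟨α, -, -, hα⟩ := exists_sum_chain (j := j) hu1 hv1 hv2 (by omega) hm
    rw [hα _ (hh j), sum_mul_harmonic_eq_zero hij (by omega) (by omega) (hh i) (hh j), mul_zero]
  simp_rw [← sum_sub_distrib]
  rw [sum_sq_sum_of_orthogonal, sum_sq_sum_of_orthogonal, mul_sum]
  · refine sum_le_sum fun j hj => ?_
    have hj : (j : ℝ) ≤ d := by exact_mod_cast Nat.lt_succ_iff.1 (mem_range.1 hj)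
    refine sum_sq_sub_harmonic_le hsn htn hms hmt (hdm.trans' (by exact_mod_cast hj)) hm
      (hx.trans' ?_) hx3 (hh j)
    gcongr
  · exact orth s s hsn hsn hms
  · intro i hi j hj hij
    simp_rw [sub_mul, mul_sub]
    simp only [sum_sub_distrib, orth t t htn htn hmt i hi j hj hij,
      orth t s htn hsn hms i hi j hj hij, orth s t hsn htn hmt i hi j hj hij,
      orth s s hsn hsn hms i hi j hj hij, sub_zero]

/-! ### Harmonic decomposition of polynomials -/

/-- Double counting of the pairs `(T, y)` with `y ∈ T ⊆ A`: remove `y` from `T`. -/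
lemma sum_powerset_sum_erase (A : Finset (Fin n)) (φ : Finset (Fin n) → Fin n → ℝ) :
    ∑ T ∈ A.powerset, ∑ y ∈ T, φ (T.erase y) y = ∑ T ∈ A.powerset, ∑ y ∈ A \ T, φ T y := by
  rw [sum_sigma', sum_sigma']
  refine sum_bij' (fun a _ => ⟨a.1.erase a.2, a.2⟩) (fun a _ => ⟨insert a.2 a.1, a.2⟩)
    ?_ ?_ ?_ ?_ ?_
  · rintro ⟨T, y⟩ h
    simp only [mem_sigma, mem_powerset, mem_sdiff, mem_erase] at h ⊢
    exact ⟨(erase_subset _ _).trans h.1, h.1 h.2, by simp⟩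
  · rintro ⟨T, y⟩ h
    simp only [mem_sigma, mem_powerset, mem_sdiff] at h ⊢
    exact ⟨insert_subset h.2.1 h.1, mem_insert_self _ _⟩
  · rintro ⟨T, y⟩ h
    simp only [mem_sigma] at h
    simp [insert_erase h.2]
  · rintro ⟨T, y⟩ h
    simp only [mem_sigma, mem_sdiff] at h
    simp [erase_insert h.2.2]
  · intro a _
    rfl

/-- The function on the cube with the coefficients `g`: the value at the indicator vector of `A`
of the multilinear polynomial `∑ T, g T * ∏ i ∈ T, x i`. -/
def evalCoeff (g : Finset (Fin n) → ℝ) (A : Finset (Fin n)) : ℝ := ∑ T ∈ A.powerset, g T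

/-- The coefficients of the degree `m + 1` part of `(∑ i, x i)` times a homogeneous polynomial of
degree `m` with coefficients `g`, after the reduction `x i ^ 2 = x i`. -/
def raise (g : Finset (Fin n) → ℝ) (T : Finset (Fin n)) : ℝ := ∑ y ∈ T, g (T.erase y)

lemma evalCoeff_raise {m : ℕ} {g : Finset (Fin n) → ℝ} (hg : ∀ T, #T ≠ m → g T = 0)
    (A : Finset (Fin n)) : evalCoeff (raise g) A = ((#A : ℝ) - m) * evalCoeff g A := by
  simp only [evalCoeff, raise]
  rw [sum_powerset_sum_erase A fun T _ => g T, mul_sum]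
  refine sum_congr rfl fun T hT => ?_
  rw [sum_const, nsmul_eq_mul, card_sdiff_of_subset (mem_powerset.1 hT),
    Nat.cast_sub (card_le_card (mem_powerset.1 hT))]
  by_cases h : #T = m
  · rw [h]
  · simp [hg T h]

lemma evalCoeff_mem_harmonic {j : ℕ} {g : Finset (Fin n) → ℝ} (hg : ∀ T, #T ≠ j → g T = 0)
    (hD : ∀ T, ∑ y ∈ Tᶜ, g (insert y T) = 0) : evalCoeff g ∈ harmonic n j := by
  have euler : ∀ A : Finset (Fin n),
      ∑ T ∈ A.powerset, ∑ y ∈ A \ T, g (insert y T) = j * evalCoeff g A := by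
    intro A
    rw [← sum_powerset_sum_erase A fun T y => g (insert y T), evalCoeff, mul_sum]
    refine sum_congr rfl fun T _ => ?_
    rw [sum_congr rfl fun y hy => by rw [insert_erase hy], sum_const, nsmul_eq_mul]
    by_cases h : #T = j
    · rw [h]
    · simp [hg T h]
  intro A
  constructor
  · have h1 : ∀ y ∈ Aᶜ, evalCoeff g (insert y A) =
        evalCoeff g A + ∑ T ∈ A.powerset, g (insert y T) := by
      intro y hy
      exact sum_powerset_insert (mem_compl.1 hy) _
    have h2 : ∀ T ∈ A.powerset, ∑ y ∈ Aᶜ, g (insert y T) = - ∑ y ∈ A \ T, g (insert y T) := by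
      intro T hT
      have hT := mem_powerset.1 hT
      rw [eq_neg_iff_add_eq_zero, ← hD T, ← sum_union]
      · congr 1
        ext y
        have := @hT y
        simp only [mem_union, mem_compl, mem_sdiff]
        tauto
      · exact disjoint_left.2 fun y h1 h2 => mem_compl.1 h1 (mem_sdiff.1 h2).1
    rw [sum_congr rfl h1, sum_add_distrib, sum_comm, sum_congr rfl h2, sum_neg_distrib, euler,
      sum_const, card_compl, Fintype.card_fin, nsmul_eq_mul,
      Nat.cast_sub (by simpa using card_le_univ A)]
    ring
  · have h1 : ∀ y ∈ A, evalCoeff g (A.erase y) =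
        evalCoeff g A - ∑ T ∈ (A.erase y).powerset, g (insert y T) := by
      intro y hy
      have := sum_powerset_insert (notMem_erase y A) g
      rw [insert_erase hy] at this
      simp only [evalCoeff, this]
      ring
    have h2 : ∑ y ∈ A, ∑ T ∈ (A.erase y).powerset, g (insert y T) =
        ∑ T ∈ A.powerset, ∑ y ∈ A \ T, g (insert y T) := by
      refine sum_comm' fun y T => ?_
      simp only [mem_powerset, mem_sdiff, subset_erase]
      tauto
    rw [sum_congr rfl h1, sum_sub_distrib, h2, euler, sum_const, nsmul_eq_mul]
    ring

/-- Every homogeneous multilinear polynomial is the sum of a harmonic one and of one in the range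
of `raise`, because lowering `g ↦ ∑ y, ∂g/∂x_y` is the adjoint of raising. -/
lemma exists_eq_harmonic_add_raise {m : ℕ} {f : Finset (Fin n) → ℝ}
    (hf : ∀ T, #T ≠ m + 1 → f T = 0) :
    ∃ h g : Finset (Fin n) → ℝ, (∀ T, #T ≠ m + 1 → h T = 0) ∧
      (∀ T, ∑ y ∈ Tᶜ, h (insert y T) = 0) ∧ (∀ T, #T ≠ m → g T = 0) ∧ f = h + raise g := by
  let V : Submodule ℝ (Finset (Fin n) → ℝ) :=
    { carrier := {g | ∀ T, #T ≠ m → g T = 0}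
      zero_mem' := fun _ _ => rfl
      add_mem' := fun ha hb T hT => by simp [ha T hT, hb T hT]
      smul_mem' := fun c a ha T hT => by simp [ha T hT] }
  let U : (Finset (Fin n) → ℝ) →ₗ[ℝ] EuclideanSpace ℝ (Finset (Fin n)) :=
    { toFun := fun g => WithLp.toLp 2 (raise g)
      map_add' := fun a b => by
        ext T; simp [raise, sum_add_distrib]
      map_smul' := fun c a => by
        ext T; simp [raise, mul_sum] }
  obtain ⟨y, hy, z, hz, hyz⟩ := (V.map U).exists_add_mem_mem_orthogonal (WithLp.toLp 2 f)
  obtain ⟨g, hg, rfl⟩ := hy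
  have hz' : ∀ T, f T = raise g T + z T := fun T => congrArg (fun w => w T) hyz
  have hz0 : ∀ T, #T ≠ m + 1 → z T = 0 := by
    intro T hT
    have h1 : raise g T = 0 := by
      refine sum_eq_zero fun y hy => hg _ ?_
      have := card_erase_add_one hy
      omega
    have := hz' T
    rw [hf T hT, h1] at this
    linarith
  refine ⟨fun T => z T, g, hz0, fun T => ?_, hg, ?_⟩
  · by_cases hT : #T = m
    · have hV : (Pi.single T 1 : Finset (Fin n) → ℝ) ∈ V := by
        intro T' hT'
        exact Pi.single_eq_of_ne (by rintro rfl; exact hT' hT) _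
      have h0 := (Submodule.mem_orthogonal _ _).1 hz _ (Submodule.mem_map_of_mem hV)
      have h1 := sum_powerset_sum_erase univ fun T' y =>
        (Pi.single T 1 : Finset (Fin n) → ℝ) T' * z (insert y T')
      rw [powerset_univ] at h1
      rw [PiLp.inner_apply] at h0
      have h2 : ∑ T', ∑ y ∈ T', (Pi.single T 1 : Finset (Fin n) → ℝ) (T'.erase y) *
          z (insert y (T'.erase y)) = 0 := by
        rw [← h0]
        refine sum_congr rfl fun T' _ => ?_
        rw [sum_congr rfl fun y hy => by rw [insert_erase hy], ← sum_mul]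
        simp [U, raise, mul_comm]
      rw [h2] at h1
      rw [h1, Fintype.sum_eq_single T]
      · simp [compl_eq_univ_sdiff]
      · intro T' hT'
        simp [Pi.single_eq_of_ne hT']
    · refine sum_eq_zero fun y hy => hz0 _ ?_
      rw [card_insert_of_notMem (mem_compl.1 hy)]
      omega
  · ext T
    rw [hz' T, Pi.add_apply, add_comm]

/-- The span of the functions `(∑ i, x i) ^ a * h` with `h` harmonic of degree `j` and
`a + j ≤ m`. -/
def harmonicSpan (n m : ℕ) : Submodule ℝ (Finset (Fin n) → ℝ) :=
  Submodule.span ℝ {f | ∃ a j, a + j ≤ m ∧ ∃ h ∈ harmonic n j, f = fun A => (#A : ℝ) ^ a * h A}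

lemma harmonicSpan_mono {m m' : ℕ} (h : m ≤ m') : harmonicSpan n m ≤ harmonicSpan n m' := by
  refine Submodule.span_mono ?_
  rintro f ⟨a, j, haj, w⟩
  exact ⟨a, j, haj.trans h, w⟩

lemma harmonic_le_harmonicSpan (m : ℕ) : harmonic n m ≤ harmonicSpan n m := fun h hh =>
  Submodule.subset_span ⟨0, m, by simp, h, hh, by simp⟩

lemma card_mul_mem_harmonicSpan {m : ℕ} {f : Finset (Fin n) → ℝ} (hf : f ∈ harmonicSpan n m) :
    (fun A => (#A : ℝ) * f A) ∈ harmonicSpan n (m + 1) := by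
  induction hf using Submodule.span_induction with
  | mem f hf =>
    obtain ⟨a, j, haj, h, hh, rfl⟩ := hf
    exact Submodule.subset_span ⟨a + 1, j, by omega, h, hh, by ext A; ring⟩
  | zero => simp only [Pi.zero_apply, mul_zero]; exact Submodule.zero_mem _
  | add f g _ _ hf hg =>
    convert Submodule.add_mem _ hf hg using 1
    ext A
    simp [mul_add]
  | smul c f _ hf =>
    convert Submodule.smul_mem _ c hf using 1
    ext A
    simp only [Pi.smul_apply, smul_eq_mul]
    ring

lemma evalCoeff_mem_harmonicSpan (m : ℕ) {f : Finset (Fin n) → ℝ}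
    (hf : ∀ T, #T ≠ m → f T = 0) : evalCoeff f ∈ harmonicSpan n m := by
  induction m generalizing f with
  | zero =>
    refine harmonic_le_harmonicSpan 0 (evalCoeff_mem_harmonic hf fun T => ?_)
    refine sum_eq_zero fun y _ => hf _ ?_
    exact (card_pos.2 ⟨y, mem_insert_self _ _⟩).ne'
  | succ m ih =>
    obtain ⟨h, g, hh, hD, hg, rfl⟩ := exists_eq_harmonic_add_raise hf
    have e : evalCoeff (h + raise g) = evalCoeff h + ((fun A => (#A : ℝ) * evalCoeff g A) -
        (m : ℝ) • evalCoeff g) := by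
      ext A
      simp only [Pi.add_apply, Pi.sub_apply, Pi.smul_apply, smul_eq_mul, ← sub_mul,
        ← evalCoeff_raise hg A]
      simp [evalCoeff, sum_add_distrib]
    rw [e]
    exact add_mem (harmonic_le_harmonicSpan _ (evalCoeff_mem_harmonic hh hD))
      (sub_mem (card_mul_mem_harmonicSpan (ih hg))
        (Submodule.smul_mem _ _ (harmonicSpan_mono m.le_succ (ih hg))))

/-- The point of the cube whose set of coordinates equal to 1 is `A`. -/
def indicatorCube (A : Finset (Fin n)) : Cube n := fun i => if i ∈ A then 1 else 0

lemma evalCube_mem_harmonicSpan {d : ℕ} {f : MvPolynomial (Fin n) ℝ} (hf : f.totalDegree ≤ d) :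
    (fun A => evalCube f (indicatorCube A)) ∈ harmonicSpan n d := by
  have e : (fun A => evalCube f (indicatorCube A)) =
      ∑ m ∈ f.support, f.coeff m • evalCoeff (Pi.single m.support 1) := by
    ext A
    rw [evalCube, MvPolynomial.eval_eq, Finset.sum_apply]
    refine sum_congr rfl fun m _ => ?_
    rw [Pi.smul_apply, smul_eq_mul]
    congr 1
    simp only [evalCoeff, Pi.single_apply, sum_ite_eq', mem_powerset, indicatorCube]
    split_ifs with h
    · exact prod_eq_one fun i hi => by simp [h hi]
    · obtain ⟨i, hi, hiA⟩ := not_subset.1 h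
      exact prod_eq_zero hi (by simp [hiA, Finsupp.mem_support_iff.1 hi])
  rw [e]
  refine Submodule.sum_mem _ fun m hm => Submodule.smul_mem _ _ ?_
  have hcard : #m.support ≤ d := by
    refine le_trans ?_ ((MvPolynomial.le_totalDegree hm).trans hf)
    rw [Finsupp.sum, card_eq_sum_ones]
    exact sum_le_sum fun i hi => Nat.one_le_iff_ne_zero.2 (Finsupp.mem_support_iff.1 hi)
  refine harmonicSpan_mono hcard (evalCoeff_mem_harmonicSpan _ fun T hT => ?_)
  exact Pi.single_eq_of_ne (by rintro rfl; exact hT rfl) _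

/-! ### Interpolation between slices -/

/-- The coefficients of Lagrange interpolation from the nodes `κ i` to the point `k`. -/
noncomputable def interpolationCoeff {d : ℕ} (κ : Fin (d + 1) → ℕ) (k : ℕ) (i : Fin (d + 1)) : ℝ :=
  (Lagrange.basis univ (fun i => (κ i : ℝ)) i).eval (k : ℝ)

lemma sum_interpolationCoeff_mul_pow {d : ℕ} {κ : Fin (d + 1) → ℕ} (hκ : Function.Injective κ)
    (k : ℕ) {a : ℕ} (ha : a ≤ d) :
    ∑ i, interpolationCoeff κ k i * (κ i : ℝ) ^ a = (k : ℝ) ^ a := by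
  have h := Lagrange.eq_interpolate (s := univ) (v := fun i => (κ i : ℝ))
    (f := (Polynomial.X : Polynomial ℝ) ^ a) (fun i _ j _ hij => hκ (Nat.cast_injective hij)) (by
      rw [Polynomial.degree_X_pow, card_univ, Fintype.card_fin]
      exact_mod_cast Nat.lt_succ_of_le ha)
  have h' := congrArg (Polynomial.eval (k : ℝ)) h
  simp only [Polynomial.eval_pow, Polynomial.eval_X, Lagrange.interpolate_apply,
    Polynomial.eval_finsetSum, Polynomial.eval_mul, Polynomial.eval_C] at h'
  rw [h']
  exact sum_congr rfl fun i _ => mul_comm _ _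

/-- A polynomial `f` of degree at most `d` agrees on each slice `κ i` with a sum of harmonic
functions of degrees at most `d`, and on the slice `k` with the interpolation between these. -/
lemma exists_harmonic_interpolation {d : ℕ} {κ : Fin (d + 1) → ℕ} (hκ : Function.Injective κ)
    (k : ℕ) {f : Finset (Fin n) → ℝ} (hf : f ∈ harmonicSpan n d) :
    ∃ F : Fin (d + 1) → ℕ → Finset (Fin n) → ℝ, (∀ i j, F i j ∈ harmonic n j) ∧
      (∀ i A, #A = κ i → f A = ∑ j ∈ range (d + 1), F i j A) ∧
      ∀ A, #A = k → f A = ∑ i, interpolationCoeff κ k i * ∑ j ∈ range (d + 1), F i j A := by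
  induction hf using Submodule.span_induction with
  | mem f hf =>
    obtain ⟨a, j, haj, h, hh, rfl⟩ := hf
    have hj : j ∈ range (d + 1) := mem_range.2 (by omega)
    have hsum : ∀ i A, ∑ j' ∈ range (d + 1),
        (Pi.single j ((κ i : ℝ) ^ a • h) : ℕ → Finset (Fin n) → ℝ) j' A = (κ i : ℝ) ^ a * h A := by
      intro i A
      rw [sum_eq_single_of_mem j hj fun j' _ hj' => by rw [Pi.single_eq_of_ne hj']; rfl,
        Pi.single_eq_same]
      rfl
    refine ⟨fun i => Pi.single j ((κ i : ℝ) ^ a • h), fun i j' => ?_, fun i A hA => ?_,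
      fun A hA => ?_⟩
    · change (Pi.single j ((κ i : ℝ) ^ a • h) : ℕ → Finset (Fin n) → ℝ) j' ∈ _
      by_cases hj' : j' = j
      · subst hj'
        rw [Pi.single_eq_same]
        exact Submodule.smul_mem _ _ hh
      · rw [Pi.single_eq_of_ne hj']
        exact Submodule.zero_mem _
    · simp only [hsum, hA]
    · simp_rw [hsum, ← mul_assoc]
      rw [← sum_mul, sum_interpolationCoeff_mul_pow hκ k (by omega), hA]
  | zero => exact ⟨0, fun _ _ => Submodule.zero_mem _, by simp, by simp⟩
  | add f g _ _ hf hg =>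
    obtain ⟨F, hF1, hF2, hF3⟩ := hf
    obtain ⟨G, hG1, hG2, hG3⟩ := hg
    refine ⟨F + G, fun i j => add_mem (hF1 i j) (hG1 i j), fun i A hA => ?_, fun A hA => ?_⟩
    · simp [hF2 i A hA, hG2 i A hA, sum_add_distrib]
    · simp [hF3 A hA, hG3 A hA, sum_add_distrib, mul_add]
  | smul c f _ hf =>
    obtain ⟨F, hF1, hF2, hF3⟩ := hf
    refine ⟨c • F, fun i j => Submodule.smul_mem _ c (hF1 i j), fun i A hA => ?_, fun A hA => ?_⟩
    · simp [hF2 i A hA, mul_sum]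
    · simp only [Pi.smul_apply, smul_eq_mul, hF3 A hA, mul_sum]
      exact sum_congr rfl fun i _ => sum_congr rfl fun j _ => by ring

/-! ### Expectations over slices and profiles -/

lemma chain_eq_indicatorCube (π : Equiv.Perm (Fin n)) (s : ℕ) :
    chain π s = indicatorCube (initialImage π s) := by
  ext i
  simp [chain, indicatorCube, mem_initialImage]

lemma sum_cube_eq_card (x : Cube n) : ∑ i, (x i : ℕ) = #{i | x i = 1} := by
  rw [card_filter]
  refine sum_congr rfl fun i _ => ?_
  generalize x i = v
  fin_cases v <;> rfl

lemma chain_mem_slice (π : Equiv.Perm (Fin n)) {k : ℕ} (hk : k ≤ n) : chain π k ∈ slice n k := by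
  have h : #{i | chain π k i = 1} = #(initialImage π k) := by
    congr 1
    ext i
    simp [chain, mem_initialImage]
  rw [slice, Set.mem_ofPred_eq, sum_cube_eq_card, h, card_initialImage π hk]

/-- The symmetric group acts transitively on each slice, so all its points are hit by the chain
equally often. -/
lemma card_chain_eq {k : ℕ} {x y : Cube n} (hx : x ∈ slice n k) (hy : y ∈ slice n k) :
    #{π : Equiv.Perm (Fin n) | chain π k = x} = #{π : Equiv.Perm (Fin n) | chain π k = y} := by
  have hcard : Fintype.card {i // x i = 1} = Fintype.card {i // y i = 1} := by
    rw [Fintype.card_subtype, Fintype.card_subtype, ← sum_cube_eq_card, ← sum_cube_eq_card]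
    exact hx.trans hy.symm
  let e := Fintype.equivOfCardEq hcard
  have hσ : ∀ i, y (e.extendSubtype i) = x i := by
    intro i
    by_cases hi : x i = 1
    · rw [hi]
      exact e.extendSubtype_mem i hi
    · have h1 := e.extendSubtype_not_mem i hi
      omega
  refine card_bij (fun π _ => e.extendSubtype * π) ?_ (fun _ _ _ _ h => mul_left_cancel h) ?_
  · intro π hπ
    rw [mem_filter] at hπ ⊢
    refine ⟨mem_univ _, funext fun i => ?_⟩
    obtain ⟨i, rfl⟩ := e.extendSubtype.surjective i
    rw [hσ]
    refine Eq.trans ?_ (congrFun hπ.2 i)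
    have : (e.extendSubtype * π).symm (e.extendSubtype i) = π.symm i :=
      congrArg π.symm (e.extendSubtype.symm_apply_apply i)
    simp only [chain, this]
  · intro π hπ
    rw [mem_filter] at hπ
    refine ⟨e.extendSubtype⁻¹ * π, ?_, by group⟩
    rw [mem_filter]
    refine ⟨mem_univ _, funext fun i => ?_⟩
    rw [← hσ]
    exact congrFun hπ.2 (e.extendSubtype i)

/-- The point `X(k)` of the chain is uniformly distributed on the slice. -/
lemma integral_nu {k : ℕ} (hk : k ≤ n) (G : Cube n → ℝ) :
    ∫ x, G x ∂(nu n k) =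
      (∑ π : Equiv.Perm (Fin n), G (chain π k)) / Fintype.card (Equiv.Perm (Fin n)) := by
  classical
  let S : Finset (Cube n) := univ.filter (· ∈ slice n k)
  have hS : ∀ x, x ∈ S ↔ x ∈ slice n k := fun x => by simp [S]
  have hmaps : ∀ π ∈ (univ : Finset (Equiv.Perm (Fin n))), chain π k ∈ S :=
    fun π _ => (hS _).2 (chain_mem_slice π hk)
  have hx0 := chain_mem_slice (1 : Equiv.Perm (Fin n)) hk
  set x₀ := chain (1 : Equiv.Perm (Fin n)) k
  have hsum : ∀ H : Cube n → ℝ, ∑ π : Equiv.Perm (Fin n), H (chain π k) =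
      #{π : Equiv.Perm (Fin n) | chain π k = x₀} * ∑ x ∈ S, H x := by
    intro H
    rw [← sum_fiberwise_of_maps_to hmaps, mul_sum]
    refine sum_congr rfl fun x hx => ?_
    rw [sum_congr rfl fun π hπ => by rw [(mem_filter.1 hπ).2], sum_const, nsmul_eq_mul,
      card_chain_eq ((hS x).1 hx) hx0]
  have hcard := hsum fun _ => 1
  simp only [sum_const, card_univ, nsmul_eq_mul, mul_one] at hcard
  have hc : (#{π : Equiv.Perm (Fin n) | chain π k = x₀} : ℝ) ≠ 0 := by
    exact_mod_cast (card_pos.2 ⟨1, by simp [x₀]⟩).ne'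
  have hν : nu n k = uniformOn (S : Set (Cube n)) := by
    rw [nu]
    congr 1
    ext x
    simp [S]
  rw [hsum, hcard, mul_div_mul_left _ _ hc, hν, integral_fintype .of_finite, sum_div,
    ← sum_subset (subset_univ S)]
  · refine sum_congr rfl fun x hx => ?_
    rw [measureReal_def, ← coe_singleton, uniformOn_apply_finset,
      inter_singleton_of_mem hx, card_singleton]
    simp [div_eq_inv_mul]
  · intro x _ hx
    rw [measureReal_def, ← coe_singleton, uniformOn_apply_finset, inter_singleton_of_notMem hx]
    simp

lemma integral_profile {r : ℕ} (f : MvPolynomial (Fin n) ℝ) (κ : Fin r → ℕ)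
    {G : (Fin r → ℝ) → ℝ} (hG : Continuous G) :
    ∫ y, G y ∂(profile f κ) = (∑ π : Equiv.Perm (Fin n), G fun i => evalCube f (chain π (κ i))) /
      Fintype.card (Equiv.Perm (Fin n)) := by
  let _ : MeasurableSpace (Equiv.Perm (Fin n)) := ⊤
  have : MeasurableSingletonClass (Equiv.Perm (Fin n)) := ⟨fun _ => trivial⟩
  have hm : Measurable fun (π : Equiv.Perm (Fin n)) i => evalCube f (chain π (κ i)) :=
    fun _ _ => trivial
  rw [profile, ← PMF.toMeasure_map _ _ hm,
    integral_map hm.aemeasurable hG.aestronglyMeasurable, PMF.integral_eq_sum, sum_div]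
  refine sum_congr rfl fun π _ => ?_
  simp [div_eq_inv_mul]

/-- The average of `φ ∘ a - φ ∘ b` is at most the `L²` norm of `a - b`. -/
lemma abs_average_lipschitz_sub_le {Ω : Type*} [Fintype Ω] [Nonempty Ω] {φ : ℝ → ℝ}
    (hφ : LipschitzWith 1 φ) (a b : Ω → ℝ) {B : ℝ} (hB : 0 ≤ B)
    (h : ∑ π, (a π - b π) ^ 2 ≤ Fintype.card Ω * B ^ 2) :
    |(∑ π, φ (a π)) / Fintype.card Ω - (∑ π, φ (b π)) / Fintype.card Ω| ≤ B := by
  have hN : (0 : ℝ) < Fintype.card Ω := by exact_mod_cast Fintype.card_pos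
  rw [← sub_div, ← sum_sub_distrib, abs_div, abs_of_pos hN, div_le_iff₀ hN]
  have h1 : |∑ π, (φ (a π) - φ (b π))| ≤ ∑ π, |a π - b π| := by
    refine (abs_sum_le_sum_abs _ _).trans (sum_le_sum fun π _ => ?_)
    simpa [Real.dist_eq] using hφ.dist_le_mul (a π) (b π)
  refine h1.trans (abs_le_of_sq_le_sq' ?_ (by positivity)).2
  have h2 := sq_sum_le_card_mul_sum_sq (s := (univ : Finset Ω)) (f := fun π => |a π - b π|)
  simp only [sq_abs, card_univ] at h2
  calc _ ≤ _ := h2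
    _ ≤ Fintype.card Ω * (Fintype.card Ω * B ^ 2) := by gcongr
    _ = _ := by ring

/-! ### The estimate in mean square -/

lemma abs_interpolationCoeff_le {p η M : ℝ} {d : ℕ} {κ : Fin (d + 1) → ℕ}
    (hN : 0 < stdDev n p) (hκ : IsSystem n p η M κ) (k : ℕ) (i : Fin (d + 1)) :
    |interpolationCoeff κ k i| ≤ ((1 + |sig n p k|) * (M / η)) ^ d := by
  have hη := hκ.eta_pos
  have hM := hκ.one_le_M
  have hsub : ∀ a b : ℕ, (a : ℝ) - b = stdDev n p * (sig n p a - sig n p b) := by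
    intro a b
    rw [sig, sig]
    field_simp
    ring
  rw [interpolationCoeff, Lagrange.basis, Polynomial.eval_prod, abs_prod]
  have hcard : #((univ : Finset (Fin (d + 1))).erase i) = d := by simp
  conv_rhs => rw [← hcard, ← prod_const]
  refine prod_le_prod (fun _ _ => abs_nonneg _) fun j hj => ?_
  have hij := hκ.separated i j (ne_of_mem_erase hj).symm
  rw [Lagrange.basisDivisor]
  simp only [Polynomial.eval_mul, Polynomial.eval_C, Polynomial.eval_sub, Polynomial.eval_X]
  rw [hsub, hsub, ← div_eq_inv_mul, mul_div_mul_left _ _ hN.ne', abs_div, ← mul_div_assoc]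
  refine div_le_div₀ (by positivity) ?_ hη hij
  have h1 := abs_sub (sig n p k) (sig n p (κ j))
  have h2 := hκ.bounded j
  nlinarith [mul_nonneg (abs_nonneg (sig n p k)) (sub_nonneg.2 hM)]

/-- The levels of a system, and those near to them, are far from `0` and `n`. -/
lemma mul_sq_stdDev_le {p η M : ℝ} (hp0 : 0 < p) (hp1 : p < 1) {d : ℕ} {κ : Fin (d + 1) → ℕ}
    (hN : 0 < stdDev n p) (hκ : IsSystem n p η M κ) (hM : M ≤ stdDev n p / 2) {k : ℕ}
    {i : Fin (d + 1)} (hk : |sig n p k - sig n p (κ i)| ≤ stdDev n p / 8) :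
    3 / 8 * stdDev n p ^ 2 ≤ k ∧ 3 / 8 * stdDev n p ^ 2 ≤ n - k ∧
      3 / 8 * stdDev n p ^ 2 ≤ κ i ∧ 3 / 8 * stdDev n p ^ 2 ≤ n - κ i := by
  have hsq : stdDev n p ^ 2 = n * p * (1 - p) := by
    refine Real.sq_sqrt (mul_nonneg (by positivity) (by linarith))
  have h1 : ∀ a : ℕ, (a : ℝ) = n * p + stdDev n p * sig n p a := by
    intro a
    rw [sig]
    field_simp
    ring
  have hb := abs_le.1 ((hκ.bounded i).trans hM)
  have hk' := abs_le.1 hk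
  have e1 : stdDev n p ^ 2 ≤ n * p := by
    rw [hsq]; nlinarith [mul_nonneg (Nat.cast_nonneg n : (0 : ℝ) ≤ n) (mul_nonneg hp0.le hp0.le)]
  have e2 : stdDev n p ^ 2 ≤ n - n * p := by
    rw [hsq]
    nlinarith [mul_nonneg (Nat.cast_nonneg n : (0 : ℝ) ≤ n) (sq_nonneg (1 - p))]
  rw [h1 k, h1 (κ i)]
  refine ⟨?_, ?_, ?_, ?_⟩ <;> nlinarith

/-- The numerical inequality that fixes the constant `10`. -/
lemma mul_add_one_sq_le_pow (d : ℕ) : 32 / 3 * (d : ℝ) * (d + 1) ^ 2 ≤ (10 ^ d) ^ 2 := by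
  induction d with
  | zero => norm_num
  | succ d ih =>
    rcases Nat.eq_zero_or_pos d with rfl | hd
    · norm_num
    · have hd' : (1 : ℝ) ≤ d := by exact_mod_cast hd
      have e : ((10 : ℝ) ^ (d + 1)) ^ 2 = 100 * (10 ^ d) ^ 2 := by ring
      rw [e]
      push_cast
      have h1 : ((d : ℝ) + 1) ≤ 2 * d := by linarith
      have h2 : ((d : ℝ) + 1 + 1) ^ 2 ≤ (2 * (d + 1)) ^ 2 := by gcongr; linarith
      calc 32 / 3 * ((d : ℝ) + 1) * (d + 1 + 1) ^ 2
          ≤ 32 / 3 * (2 * d) * (2 * (d + 1)) ^ 2 := by gcongr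
        _ = 8 * (32 / 3 * (d : ℝ) * (d + 1) ^ 2) := by ring
        _ ≤ 100 * (10 ^ d) ^ 2 := by nlinarith [sq_nonneg ((10 : ℝ) ^ d)]

/-- The `L²` form of the theorem, for the coupling given by the chain: interpolate `f` on the
slice `k` by its harmonic extensions from the slices `κ i`, and move each of these from `k` to
`κ i`. -/
lemma sum_sq_sub_interpolation_le {p η M : ℝ} (hp0 : 0 < p) (hp1 : p < 1) {d : ℕ} (hd : 1 ≤ d)
    {κ : Fin (d + 1) → ℕ} (hN : 0 < stdDev n p) (hdN : (d : ℝ) ≤ 1 / 16 * stdDev n p ^ 2) {k : ℕ}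
    (hk : k ≤ n) (hL : maxDist n p k κ ≤ stdDev n p / (8 * d)) (hκ : IsSystem n p η M κ)
    (hM : M ≤ stdDev n p / 2) {f : MvPolynomial (Fin n) ℝ} (hf : f.totalDegree ≤ d)
    (hf1 : ∀ i, ∑ π : Equiv.Perm (Fin n), evalCube f (chain π (κ i)) ^ 2 ≤
      Fintype.card (Equiv.Perm (Fin n))) :
    ∑ π : Equiv.Perm (Fin n), (evalCube f (chain π k) -
        ∑ i, interpolationCoeff κ k i * evalCube f (chain π (κ i))) ^ 2 ≤
      Fintype.card (Equiv.Perm (Fin n)) * ((10 * ((1 + |sig n p k|) * (M / η))) ^ d *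
        Real.sqrt (maxDist n p k κ / stdDev n p)) ^ 2 := by
  have hd' : (1 : ℝ) ≤ d := by exact_mod_cast hd
  have hinj : Function.Injective κ := by
    intro i j hij
    by_contra hne
    have h1 := hκ.separated i j hne
    rw [hij, sub_self, abs_zero] at h1
    exact absurd hκ.eta_pos h1.not_gt
  have hLi : ∀ i, |sig n p k - sig n p (κ i)| ≤ maxDist n p k κ := fun i =>
    le_ciSup (f := fun i => |sig n p k - sig n p (κ i)|) (Set.finite_range _).bddAbove i
  have hL0 : 0 ≤ maxDist n p k κ := (abs_nonneg _).trans (hLi 0)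
  set N := stdDev n p with hNdef
  set L := maxDist n p k κ
  set G := (1 + |sig n p k|) * (M / η) with hG
  have hLN : d * L / N ≤ 1 / 8 := by
    rw [le_div_iff₀ (by positivity)] at hL
    rw [div_le_iff₀ hN]
    linarith
  obtain ⟨F, hF1, hF2, hF3⟩ := exists_harmonic_interpolation hinj k (evalCube_mem_harmonicSpan hf)
  let Y : Fin (d + 1) → Equiv.Perm (Fin n) → ℝ := fun i π =>
    ∑ j ∈ range (d + 1), F i j (initialImage π k) -
      ∑ j ∈ range (d + 1), F i j (initialImage π (κ i))
  have hY : ∀ π, evalCube f (chain π k) -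
      ∑ i, interpolationCoeff κ k i * evalCube f (chain π (κ i)) =
      ∑ i, interpolationCoeff κ k i * Y i π := by
    intro π
    simp only [chain_eq_indicatorCube]
    rw [hF3 _ (card_initialImage π hk), ← sum_sub_distrib]
    refine sum_congr rfl fun i _ => ?_
    rw [hF2 i _ (card_initialImage π (hκ.le_n i)), ← mul_sub]
  have hYi : ∀ i, ∑ π, Y i π ^ 2 ≤
      4 * (8 / 3 * (d * L / N)) * Fintype.card (Equiv.Perm (Fin n)) := by
    intro i
    have hk8 : |sig n p k - sig n p (κ i)| ≤ N / 8 := by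
      refine (hLi i).trans (hL.trans ?_)
      gcongr
      linarith
    obtain ⟨b1, b2, b3, b4⟩ := mul_sq_stdDev_le hp0 hp1 hN hκ hM hk8
    have hκn := hκ.le_n i
    -- the least distance of the levels `k` and `κ i` from `0` and `n`
    let m := min (min k (n - k)) (min (κ i) (n - κ i))
    have hm : 3 / 8 * N ^ 2 ≤ (m : ℝ) := by
      simp only [m, Nat.cast_min, Nat.cast_sub hk, Nat.cast_sub hκn]
      exact le_min (le_min b1 b2) (le_min b3 b4)
    have hdm : d ≤ m := by
      have : (d : ℝ) ≤ m := by nlinarith [sq_nonneg N]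
      exact_mod_cast this
    have hdist : d * |(k : ℝ) - κ i| / m ≤ 8 / 3 * (d * L / N) := by
      have e : (k : ℝ) - κ i = N * (sig n p k - sig n p (κ i)) := by
        rw [sig, sig, ← hNdef]
        field_simp
        ring
      rw [e, abs_mul, abs_of_pos hN]
      calc (d : ℝ) * (N * |sig n p k - sig n p (κ i)|) / m
          ≤ d * (N * L) / (3 / 8 * N ^ 2) := by gcongr; exact hLi i
        _ = 8 / 3 * (d * L / N) := by field_simp
    have h := sum_sq_sub_sum_harmonic_le (n := n) (d := d) (m := m) (s := κ i) (t := k)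
      (by omega) (by omega) (by omega) (by omega) hdm (by omega) hdist (by linarith) (hF1 i)
    refine h.trans ?_
    gcongr
    refine le_of_eq_of_le (sum_congr rfl fun π _ => ?_) (hf1 i)
    rw [chain_eq_indicatorCube, ← hF2 i _ (card_initialImage π hκn)]
  have hγ : ∀ i, interpolationCoeff κ k i ^ 2 ≤ (G ^ d) ^ 2 := fun i =>
    sq_le_sq' (by linarith [(abs_le.1 (abs_interpolationCoeff_le hN hκ k i)).1])
      (abs_le.1 (abs_interpolationCoeff_le hN hκ k i)).2
  clear_value G
  calc ∑ π : Equiv.Perm (Fin n), (evalCube f (chain π k) -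
        ∑ i, interpolationCoeff κ k i * evalCube f (chain π (κ i))) ^ 2
      ≤ ∑ π : Equiv.Perm (Fin n), ((d + 1 : ℕ) : ℝ) *
          ∑ i, (interpolationCoeff κ k i * Y i π) ^ 2 := by
        refine sum_le_sum fun π _ => ?_
        rw [hY]
        simpa using sq_sum_le_card_mul_sum_sq (s := (univ : Finset (Fin (d + 1))))
          (f := fun i => interpolationCoeff κ k i * Y i π)
    _ = ((d + 1 : ℕ) : ℝ) * ∑ i, interpolationCoeff κ k i ^ 2 * ∑ π, Y i π ^ 2 := by
        rw [← mul_sum, sum_comm]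
        simp only [mul_pow, mul_sum]
    _ ≤ ((d + 1 : ℕ) : ℝ) * ∑ i : Fin (d + 1), (G ^ d) ^ 2 *
          (4 * (8 / 3 * (d * L / N)) * Fintype.card (Equiv.Perm (Fin n))) := by
        refine mul_le_mul_of_nonneg_left (sum_le_sum fun i _ => ?_) (Nat.cast_nonneg _)
        exact mul_le_mul (hγ i) (hYi i) (sum_nonneg fun π _ => sq_nonneg _) (sq_nonneg _)
    _ = (32 / 3 * d * (d + 1) ^ 2) *
          (Fintype.card (Equiv.Perm (Fin n)) * (G ^ d) ^ 2 * (L / N)) := by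
        rw [sum_const, card_univ, Fintype.card_fin, nsmul_eq_mul]
        push_cast
        ring
    _ ≤ (10 ^ d) ^ 2 * (Fintype.card (Equiv.Perm (Fin n)) * (G ^ d) ^ 2 * (L / N)) := by
        gcongr
        exact mul_add_one_sq_le_pow d
    _ = _ := by
        rw [mul_pow _ (Real.sqrt _), Real.sq_sqrt (by positivity), mul_pow]
        ring

end SliceInvariance

theorem mainTheorem4 :
    ∃ K : ℝ, 0 < K ∧ ∃ C : ℝ, 0 < C ∧
      ∀ (n : ℕ) (p : ℝ), 0 < p → p < 1 →
      ∀ (d : ℕ), 1 ≤ d → (d : ℝ) ≤ Real.sqrt (K * n * p * (1 - p)) →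
      ∀ (κ : Fin (d + 1) → ℕ) (k : ℕ), k ≤ n →
        SliceInvariance.maxDist n p k κ ≤ SliceInvariance.stdDev n p / (8 * d) →
        ∃ γ : Fin (d + 1) → ℝ,
          ∀ (η M : ℝ), SliceInvariance.IsSystem n p η M κ →
            M ≤ SliceInvariance.stdDev n p / 2 →
            (∀ i, |γ i| ≤ (C * ((1 + |SliceInvariance.sig n p k|) * (M / η))) ^ d) ∧
            ∀ f : MvPolynomial (Fin n) ℝ, SliceInvariance.IsMultilinear f → f.totalDegree ≤ d →
              (∀ i, SliceInvariance.sliceNorm (κ i) f ≤ 1) →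
              ∀ φ : ℝ → ℝ, LipschitzWith 1 φ →
                |(∫ x, φ (SliceInvariance.evalCube f x) ∂(SliceInvariance.nu n k))
                    - ∫ y, φ (∑ i, γ i * y i) ∂(SliceInvariance.profile f κ)|
                  ≤ (C * ((1 + |SliceInvariance.sig n p k|) * (M / η))) ^ d
                      * Real.sqrt (SliceInvariance.maxDist n p k κ / SliceInvariance.stdDev n p) := by
  refine ⟨1 / 16, by norm_num, 10, by norm_num, fun n p hp0 hp1 d hd hdK κ k hk hL =>
    ⟨SliceInvariance.interpolationCoeff κ k, fun η M hκ hM => ?_⟩⟩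
  have hM0 : 0 < M := one_pos.trans_le hκ.one_le_M
  have hη := hκ.eta_pos
  have hN : 0 < SliceInvariance.stdDev n p := by linarith
  have hd' : (1 : ℝ) ≤ d := by exact_mod_cast hd
  have hdN : (d : ℝ) ≤ 1 / 16 * SliceInvariance.stdDev n p ^ 2 := by
    have h1 : (1 / 16 * n * p * (1 - p) : ℝ) = 1 / 16 * SliceInvariance.stdDev n p ^ 2 := by
      rw [SliceInvariance.stdDev, Real.sq_sqrt (mul_nonneg (by positivity) (by linarith))]
      ring
    rw [h1, Real.le_sqrt (by positivity) (by positivity)] at hdK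
    -- the hypothesis bounds `d ^ 2`, hence also `d`, because `1 ≤ d`
    nlinarith
  refine ⟨fun i => (SliceInvariance.abs_interpolationCoeff_le hN hκ k i).trans ?_,
    fun f _ hf hf1 φ hφ => ?_⟩
  · refine pow_le_pow_left₀ (by positivity) (le_mul_of_one_le_left (by positivity) ?_) d
    norm_num
  · have hcont : Continuous fun y : Fin (d + 1) → ℝ =>
        φ (∑ i, SliceInvariance.interpolationCoeff κ k i * y i) :=
      hφ.continuous.comp (by fun_prop)
    rw [SliceInvariance.integral_nu hk, SliceInvariance.integral_profile f κ hcont]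
    refine SliceInvariance.abs_average_lipschitz_sub_le hφ
      (fun π => SliceInvariance.evalCube f (SliceInvariance.chain π k))
      (fun π => ∑ i, SliceInvariance.interpolationCoeff κ k i *
        SliceInvariance.evalCube f (SliceInvariance.chain π (κ i))) (by positivity) ?_
    refine SliceInvariance.sum_sq_sub_interpolation_le hp0 hp1 hd hN hdN hk hL hκ hM hf fun i => ?_
    have h1 := hf1 i
    rw [SliceInvariance.sliceNorm, SliceInvariance.integral_nu (hκ.le_n i), Real.sqrt_le_one,
      div_le_one (by exact_mod_cast Fintype.card_pos)] at h1
    exact h1
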